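/- For $p>0$, $\alpha>0$ and a function $f$ holomorphic in the open unit disc $\mathbb{D}$, let \[ M_p^p(r,f)=\frac1{2\pi}\int_0^{2\pi}|f(re^{it})|^p\,dt ,\qquad \|f\|_{\alpha,p}^p=|f(0)|^p+\int_0^1\Big(\frac{d}{dr}M_p^p(r,f)\Big)(1-r^2)^{\alpha-1}\,dr\in[0,\infty], \] and let $A^p_\alpha$ be the set of all holomorphic $f$ on $\mathbb{D}$ with $\|f\|_{\alpha,p}<\infty$. If $0<\alpha<\tfrac12$ and $p>q>0$, then $A^p_\alpha\not\subset A^q_\alpha$. That is, there is a holomorphic function $f$ on $\mathbb{D}$ with $\|f\|_{\alpha,p}<\infty$ and $\|f\|_{\alpha,q}=\infty$; in particular, for this $f$ the map $s\mapsto\|f\|_{\alpha,s}$ is not increasing (that is, not non-decreasing) on $(0,\infty)$. -/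

import Mathlib

open scoped ENNReal

noncomputable section

/-- The integral mean `M_p^p(r, f) = (1 / 2π) ∫_0^{2π} |f(r e^{it})|^p dt`. -/
def integralMean (p : ℝ) (f : ℂ → ℂ) (r : ℝ) : ℝ :=
  Real.circleAverage (fun z : ℂ => ‖f z‖ ^ p) 0 r

/-- The quantity
`‖f‖_{α,p}^p = |f(0)|^p + ∫_0^1 (d/dr M_p^p(r, f)) (1 - r^2)^{α - 1} dr`, with values in `[0, ∞]`.
For `p > 0` and `f` holomorphic in the unit disc, `r ↦ M_p^p(r, f)` is non-decreasing and
continuously differentiable on `(0, 1)`, so the integrand is a non-negative real number. -/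
def normPow (α p : ℝ) (f : ℂ → ℂ) : ℝ≥0∞ :=
  ENNReal.ofReal (‖f 0‖ ^ p) +
    ∫⁻ r in Set.Ioo (0 : ℝ) 1,
      ENNReal.ofReal (deriv (integralMean p f) r * (1 - r ^ 2) ^ (α - 1))

/-- The "norm" `‖f‖_{α,p}`, equal to `∞` when the defining integral diverges. -/
def weightedNorm (α p : ℝ) (f : ℂ → ℂ) : ℝ≥0∞ :=
  normPow α p f ^ (1 / p)

/-- The class `A^p_α` of the functions `f` that are holomorphic in the open unit disc (only the
values there matter) and for which `‖f‖_{α,p}^p` is finite. -/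
def classA (α p : ℝ) : Set (ℂ → ℂ) :=
  {f | DifferentiableOn ℂ f (Metric.ball 0 1) ∧ normPow α p f < ∞}

end

/-! Take f(z) = (1 - z)^c exp(-1/(1 - z)) and D = |1 - z|². Since Re 1/(1 - z) = 1/2 + (1 -
r²)/(2D), the radial derivative of |f|^s at angle θ is largest around θ ≈ √(1 - r), where D ≈ 1 - r
and the exponential is of order 1. A window of width √(1 - r) on which the derivative has size (1 -
r)^(cs/2 - 1) suggests (1 - r)^((cs - 1)/2) for the derivative of the mean. Against (1 - r)^(α - 1)
this converges only if cs > 1 - 2α, so some c with cq < 1 - 2α < cp separates the exponents.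
Convergence rests on `exists_deriv_integralMean_le`, which loses an arbitrarily small power;
divergence on `exists_le_deriv_integralMean`. -/

/-- The squared distance from `1` to the point of modulus `r` whose argument has cosine `t`. -/
noncomputable def sqDist (r t : ℝ) : ℝ := 1 - 2 * r * t + r ^ 2

/-- `log |f|` for `f z = (1 - z) ^ c * exp (-1 / (1 - z))`, in terms of the modulus `r` of `z` and
the cosine `t` of its argument. -/
noncomputable def logModulus (c r t : ℝ) : ℝ := c / 2 * Real.log (sqDist r t) - (1 - r * t) / sqDist r t

/-- The radial derivative of `logModulus`. -/
noncomputable def logModulusDeriv (c r t : ℝ) : ℝ :=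
  c * (r - t) / sqDist r t + (2 * r - t * (1 + r ^ 2)) / sqDist r t ^ 2

/-- The function `(1 - z) ^ c * exp (-1 / (1 - z))`. -/
noncomputable def singularFun (c : ℝ) (z : ℂ) : ℂ := Complex.exp (c * Complex.log (1 - z) - (1 - z)⁻¹)

/-! ### Pointwise bounds for the radial derivative of |f|^s -/

section Estimates

variable {c s r t : ℝ}

lemma sq_one_sub_le_sqDist (hr : 0 ≤ r) (ht : t ≤ 1) : (1 - r) ^ 2 ≤ sqDist r t := by
  unfold sqDist; nlinarith [mul_nonneg hr (sub_nonneg.2 ht)]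

lemma sqDist_pos (hr : 0 ≤ r) (hr1 : r < 1) (ht : t ≤ 1) : 0 < sqDist r t :=
  lt_of_lt_of_le (by have := sub_pos.2 hr1; positivity) (sq_one_sub_le_sqDist hr ht)

lemma half_one_sub_le_sqDist (hr : 0 ≤ r) (ht : -1 ≤ t) (ht1 : t ≤ 1) :
    (1 - t) / 2 ≤ sqDist r t := by
  unfold sqDist
  nlinarith [mul_nonneg (sq_nonneg (1 - r)) (by linarith : 0 ≤ 1 + t),
    mul_nonneg (sub_nonneg.2 ht1) (mul_nonneg hr (by linarith : 0 ≤ r + 2))]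

lemma sqDist_le_four (hr : 0 ≤ r) (hr1 : r < 1) (ht : -1 ≤ t) : sqDist r t ≤ 4 := by
  unfold sqDist; nlinarith [mul_nonneg hr (by linarith : 0 ≤ 1 + t)]

lemma logModulus_eq (hD : sqDist r t ≠ 0) :
    logModulus c r t =
      c / 2 * Real.log (sqDist r t) - 1 / 2 - (1 - r ^ 2) / (2 * sqDist r t) := by
  have h : 1 - r * t = (sqDist r t + (1 - r ^ 2)) / 2 := by unfold sqDist; ring
  unfold logModulus
  rw [h]; field_simp; ring

lemma exp_mul_logModulus (hD : 0 < sqDist r t) :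
    Real.exp (s * logModulus c r t) =
      sqDist r t ^ (c * s / 2) * Real.exp (-(s / 2)) *
        Real.exp (-(s * (1 - r ^ 2) / (2 * sqDist r t))) := by
  rw [logModulus_eq hD.ne', Real.rpow_def_of_pos hD, ← Real.exp_add, ← Real.exp_add]
  congr 1; ring

lemma exp_mul_logModulus_le (hs : 0 ≤ s) (hr : 0 ≤ r) (hr1 : r < 1) (ht : t ≤ 1) :
    Real.exp (s * logModulus c r t) ≤
      sqDist r t ^ (c * s / 2) * Real.exp (-(s * (1 - r) / (2 * sqDist r t))) := by
  have hD := sqDist_pos hr hr1 ht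
  rw [exp_mul_logModulus hD, mul_assoc]
  gcongr ?_ * ?_
  rw [← Real.exp_add, Real.exp_le_exp]
  have : s * (1 - r) / (2 * sqDist r t) ≤ s * (1 - r ^ 2) / (2 * sqDist r t) := by
    gcongr; nlinarith
  linarith

/-- The second numerator is 2r(1 - t) - t(1 - r)², while D = (1 - r)² + 2r(1 - t), so one factor of
D cancels. -/
lemma abs_logModulusDeriv_le (hc : 0 ≤ c) (hr : 0 ≤ r) (hr1 : r < 1) (ht : -1 ≤ t)
    (ht1 : t ≤ 1) : |logModulusDeriv c r t| ≤ (2 * c + 3) / sqDist r t := by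
  have hD := sqDist_pos hr hr1 ht1
  have h1 : |c * (r - t)| ≤ 2 * c := by
    rw [abs_mul, abs_of_nonneg hc, mul_comm]
    gcongr
    rw [abs_le]; constructor <;> linarith
  have h2 : |2 * r - t * (1 + r ^ 2)| ≤ 3 * sqDist r t := by
    rw [abs_le]; unfold sqDist
    constructor <;> nlinarith [mul_nonneg hr (sub_nonneg.2 ht1), sq_nonneg (1 - r),
      mul_nonneg (sq_nonneg (1 - r)) (by linarith : 0 ≤ 1 + t),
      mul_nonneg (sq_nonneg (1 - r)) (by linarith : 0 ≤ 1 - t),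
      mul_nonneg (sq_nonneg (1 + r)) (by linarith : 0 ≤ 1 - t)]
  unfold logModulusDeriv
  calc _ ≤ |c * (r - t) / sqDist r t| + |(2 * r - t * (1 + r ^ 2)) / sqDist r t ^ 2| :=
        abs_add_le _ _
    _ = |c * (r - t)| / sqDist r t + |2 * r - t * (1 + r ^ 2)| / sqDist r t ^ 2 := by
        rw [abs_div, abs_div, abs_of_pos hD, abs_of_pos (pow_pos hD 2)]
    _ ≤ 2 * c / sqDist r t + 3 * sqDist r t / sqDist r t ^ 2 := by gcongr
    _ = _ := by field_simp

/-- Writing r - t = (1 - t) - (1 - r), only -c(1 - r)D has the wrong sign in the `c` term; `hcr`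
bounds it by D/4. -/
lemma le_logModulusDeriv (hc : 0 ≤ c) (hr : 0 ≤ r) (hr1 : r < 1) (ht1 : t ≤ 1)
    (hcr : c * (1 - r) ≤ 1 / 4) :
    ((1 - t) / 2 - 2 * (1 - r) ^ 2) / sqDist r t ^ 2 ≤ logModulusDeriv c r t := by
  have hD := sqDist_pos hr hr1 ht1
  have h : logModulusDeriv c r t =
      (c * (r - t) * sqDist r t + (2 * r - t * (1 + r ^ 2))) / sqDist r t ^ 2 := by
    unfold logModulusDeriv; field_simp
  rw [h]
  gcongr
  have h1 : 0 ≤ c * (1 - t) * sqDist r t := by have := sub_nonneg.2 ht1; positivity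
  have h2 : c * (1 - r) * sqDist r t ≤ 1 / 4 * sqDist r t := by gcongr
  have h3 : sqDist r t = (1 - r) ^ 2 + 2 * r * (1 - t) := by unfold sqDist; ring
  have h4 : r * (1 - t) ≤ 1 - t := by nlinarith
  nlinarith [mul_nonneg (sq_nonneg r) (sub_nonneg.2 ht1), sq_nonneg (1 - r)]

lemma hasDerivAt_logModulus (hr : 0 ≤ r) (hr1 : r < 1) (ht1 : t ≤ 1) :
    HasDerivAt (fun x => logModulus c x t) (logModulusDeriv c r t) r := by
  have hD := sqDist_pos hr hr1 ht1
  have h1 : HasDerivAt (fun x => sqDist x t) (2 * r - 2 * t) r := by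
    unfold sqDist
    have := (((hasDerivAt_id r).const_mul 2).mul_const t).const_sub 1 |>.add
      ((hasDerivAt_id r).pow 2)
    exact this.congr_deriv (by simp; ring)
  have h2 : HasDerivAt (fun x => 1 - x * t) (-t) r := by
    simpa using ((hasDerivAt_id r).mul_const t).const_sub 1
  have h3 := ((h1.log hD.ne').const_mul (c / 2)).sub (h2.div h1 hD.ne')
  refine h3.congr_deriv ?_
  unfold logModulusDeriv
  rw [show -t * sqDist r t - (1 - r * t) * (2 * r - 2 * t) = -(2 * r - t * (1 + r ^ 2)) by
    unfold sqDist; ring]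
  ring

lemma hasDerivAt_exp_mul_logModulus (hr : 0 ≤ r) (hr1 : r < 1) (ht1 : t ≤ 1) :
    HasDerivAt (fun x => Real.exp (s * logModulus c x t))
      (Real.exp (s * logModulus c r t) * (s * logModulusDeriv c r t)) r :=
  ((hasDerivAt_logModulus hr hr1 ht1).const_mul s).exp

lemma rpow_le_exp {x γ : ℝ} (hx : 0 < x) (hγ : 0 ≤ γ) (hγ1 : γ ≤ 1) : x ^ γ ≤ Real.exp x := by
  have h := Real.add_one_le_exp x
  rcases le_total x 1 with h1 | h1
  · linarith [Real.rpow_le_one hx.le h1 hγ]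
  · have := Real.rpow_le_rpow_of_exponent_le h1 hγ1
    rw [Real.rpow_one] at this
    linarith

/-- The free γ decides how the decay is shared between powers of 1 - r and of D. -/
lemma exp_neg_le_rpow {x γ : ℝ} (hx : 0 < x) (hγ : 0 ≤ γ) (hγ1 : γ ≤ 1) :
    Real.exp (-x) ≤ x ^ (-γ) := by
  rw [Real.exp_neg, Real.rpow_neg hx.le]
  exact inv_anti₀ (by positivity) (rpow_le_exp hx hγ hγ1)

lemma exp_neg_le_two_div_sq {x : ℝ} (hx : 0 < x) : Real.exp (-x) ≤ 2 / x ^ 2 := by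
  rw [Real.exp_neg, inv_le_comm₀ (by positivity) (by positivity), inv_div]
  linarith [Real.quadratic_le_exp_of_nonneg hx.le]

/-- The modulus of the radial derivative of `|f| ^ s` is controlled by separated powers of the
distance to the circle and of `1 - t`. -/
lemma exists_abs_deriv_le (hc : 0 ≤ c) (hs : 0 < s) {γ : ℝ} (hγ : 0 ≤ γ) (hγ1 : γ ≤ 1)
    (he : c * s / 2 - 1 + γ ≤ 0) :
    ∃ C : ℝ, 0 ≤ C ∧ ∀ r t : ℝ, 0 ≤ r → r < 1 → -1 ≤ t → t < 1 →
      |Real.exp (s * logModulus c r t) * (s * logModulusDeriv c r t)| ≤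
        C * (1 - r) ^ (-γ) * ((1 - t) / 2) ^ (c * s / 2 - 1 + γ) := by
  refine ⟨s * (2 * c + 3) * (s / 2) ^ (-γ), by positivity, fun r t hr hr1 ht ht1 => ?_⟩
  have hD := sqDist_pos hr hr1 ht1.le
  have hδ : 0 < 1 - r := sub_pos.2 hr1
  have hw : 0 < (1 - t) / 2 := by linarith
  have h0 : s * (1 - r) / (2 * sqDist r t) = s / 2 * (1 - r) * (sqDist r t)⁻¹ := by
    field_simp
  have h1 : Real.exp (-(s * (1 - r) / (2 * sqDist r t))) ≤
      (s / 2) ^ (-γ) * (1 - r) ^ (-γ) * sqDist r t ^ γ := by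
    refine (exp_neg_le_rpow (by positivity) hγ hγ1).trans_eq ?_
    rw [h0, Real.mul_rpow (by positivity) (by positivity), Real.mul_rpow (by positivity) hδ.le,
      Real.inv_rpow hD.le, Real.rpow_neg hD.le, inv_inv]
  rw [abs_mul, Real.abs_exp, abs_mul, abs_of_pos hs]
  calc _ ≤ (sqDist r t ^ (c * s / 2) * ((s / 2) ^ (-γ) * (1 - r) ^ (-γ) * sqDist r t ^ γ)) *
        (s * ((2 * c + 3) / sqDist r t)) := by
        gcongr
        · exact (exp_mul_logModulus_le hs.le hr hr1 ht1.le).trans (by gcongr)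
        · exact abs_logModulusDeriv_le hc hr hr1 ht ht1.le
    _ = s * (2 * c + 3) * (s / 2) ^ (-γ) * (1 - r) ^ (-γ) *
        sqDist r t ^ (c * s / 2 - 1 + γ) := by
        rw [Real.rpow_add hD, Real.rpow_sub hD, Real.rpow_one]; ring
    _ ≤ _ := by
        gcongr ?_ * ?_
        exact Real.rpow_le_rpow_of_nonpos hw (half_one_sub_le_sqDist hr ht ht1.le) he

/-- The error (1 - r)²/D² is cancelled by e^(-x) ≤ 2/x² with x comparable to (1 - r)/D, leaving a
constant. -/
lemma exists_le_deriv (hc : 0 ≤ c) (hs : 0 < s) :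
    ∃ C : ℝ, 0 ≤ C ∧ ∀ r t : ℝ, 0 ≤ r → r < 1 → -1 ≤ t → t ≤ 1 → c * (1 - r) ≤ 1 / 4 →
      Real.exp (s * logModulus c r t) * (s * ((1 - t) / 2 / sqDist r t ^ 2)) - C ≤
      Real.exp (s * logModulus c r t) * (s * logModulusDeriv c r t) := by
  refine ⟨4 ^ (c * s / 2) * (16 / s), by positivity, fun r t hr hr1 ht ht1 hcr => ?_⟩
  have hD := sqDist_pos hr hr1 ht1
  have hδ : 0 < 1 - r := sub_pos.2 hr1
  have h1 : Real.exp (s * logModulus c r t) * (s * (2 * (1 - r) ^ 2 / sqDist r t ^ 2)) ≤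
      4 ^ (c * s / 2) * (16 / s) := by
    calc _ ≤ (4 ^ (c * s / 2) * (2 / (s * (1 - r) / (2 * sqDist r t)) ^ 2)) *
          (s * (2 * (1 - r) ^ 2 / sqDist r t ^ 2)) := by
          gcongr
          refine (exp_mul_logModulus_le hs.le hr hr1 ht1).trans ?_
          gcongr
          · exact sqDist_le_four hr hr1 ht
          · exact exp_neg_le_two_div_sq (by positivity)
      _ = _ := by field_simp; norm_num
  have h2 := mul_le_mul_of_nonneg_left (le_logModulusDeriv hc hr hr1 ht1 hcr)
    (by positivity : 0 ≤ Real.exp (s * logModulus c r t) * s)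
  rw [sub_div, mul_sub] at h2
  linarith

lemma exists_le_main_term (hc : 0 ≤ c) (hs : 0 < s) :
    ∃ K : ℝ, 0 < K ∧ ∀ r t : ℝ, 0 ≤ r → r < 1 → -1 ≤ t → (1 - r) / 5 ≤ 1 - t →
      1 - t ≤ 2 * (1 - r) → K * ((1 - r) ^ (c * s / 2) / (1 - r)) ≤
      Real.exp (s * logModulus c r t) * (s * ((1 - t) / 2 / sqDist r t ^ 2)) := by
  refine ⟨(1 / 10) ^ (c * s / 2) * Real.exp (-(s / 2)) * Real.exp (-(10 * s)) * (s / 250),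
    by positivity, fun r t hr hr1 ht h5 h2 => ?_⟩
  have hδ : 0 < 1 - r := sub_pos.2 hr1
  have ht1 : t ≤ 1 := by linarith
  have hD := sqDist_pos hr hr1 ht1
  have hDl : 1 / 10 * (1 - r) ≤ sqDist r t := by
    linarith [half_one_sub_le_sqDist hr ht ht1]
  have hDu : sqDist r t ≤ 5 * (1 - r) := by unfold sqDist; nlinarith
  rw [exp_mul_logModulus hD]
  calc _ = ((1 / 10 * (1 - r)) ^ (c * s / 2) * Real.exp (-(s / 2)) * Real.exp (-(10 * s))) *
        (s * ((1 - r) / 5 / 2 / (5 * (1 - r)) ^ 2)) := by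
        rw [Real.mul_rpow (by norm_num) hδ.le]; field_simp; norm_num
    _ ≤ _ := by
        gcongr
        rw [div_le_iff₀ (by positivity)]
        nlinarith [mul_nonneg hs.le (sub_nonneg.2 hDl), mul_nonneg hs.le (sq_nonneg (1 - r))]

end Estimates

/-! ### Integral means and the weighted integral -/

section Analytic

open MeasureTheory Set

variable {c s r : ℝ}

lemma differentiableOn_singularFun (c : ℝ) :
    DifferentiableOn ℂ (singularFun c) (Metric.ball 0 1) := by
  intro z hz
  have hre : 0 < (1 - z).re := by
    have h1 := Complex.re_le_norm z
    have h2 : ‖z‖ < 1 := by simpa using hz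
    simp only [Complex.sub_re, Complex.one_re]
    linarith
  have h0 : 1 - z ≠ 0 := fun h => by simp [h] at hre
  have h1 : DifferentiableAt ℂ (fun z : ℂ => 1 - z) z := by fun_prop
  unfold singularFun
  exact ((((h1.clog (Complex.mem_slitPlane_iff.2 (.inl hre))).const_mul _).sub
    (h1.inv h0)).cexp).differentiableWithinAt

lemma norm_singularFun_circleMap_rpow (θ : ℝ) :
    ‖singularFun c (circleMap 0 r θ)‖ ^ s = Real.exp (s * logModulus c r (Real.cos θ)) := by
  have hre : (circleMap 0 r θ).re = r * Real.cos θ := by simp [circleMap, Complex.exp_re]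
  have him : (circleMap 0 r θ).im = r * Real.sin θ := by simp [circleMap, Complex.exp_im]
  have hn : Complex.normSq (1 - circleMap 0 r θ) = sqDist r (Real.cos θ) := by
    rw [Complex.normSq_apply, Complex.sub_re, Complex.sub_im, hre, him, sqDist]
    simp only [Complex.one_re, Complex.one_im]
    linear_combination r ^ 2 * Real.sin_sq_add_cos_sq θ
  have hlog : Real.log ‖1 - circleMap 0 r θ‖ = 1 / 2 * Real.log (sqDist r (Real.cos θ)) := by
    rw [← hn, Complex.normSq_eq_norm_sq, Real.log_pow]; push_cast; ring
  rw [singularFun, Complex.norm_exp, ← Real.exp_mul, Complex.sub_re, Complex.re_ofReal_mul,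
    Complex.log_re, Complex.inv_re, hlog, hn, Complex.sub_re, hre, Complex.one_re, logModulus]
  congr 1; ring

lemma integralMean_singularFun :
    integralMean s (singularFun c) r =
      (2 * Real.pi)⁻¹ * ∫ θ in 0..2 * Real.pi, Real.exp (s * logModulus c r (Real.cos θ)) := by
  simp_rw [integralMean, Real.circleAverage, norm_singularFun_circleMap_rpow, smul_eq_mul]

lemma continuous_logModulus_cos (hr : 0 ≤ r) (hr1 : r < 1) :
    Continuous fun θ : ℝ => logModulus c r (Real.cos θ) := by
  have hD : ∀ θ : ℝ, sqDist r (Real.cos θ) ≠ 0 := fun θ =>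
    (sqDist_pos hr hr1 (Real.cos_le_one θ)).ne'
  have hc : Continuous fun θ : ℝ => sqDist r (Real.cos θ) := by unfold sqDist; fun_prop
  unfold logModulus
  exact (continuous_const.mul (hc.log hD)).sub ((by fun_prop : Continuous _).div hc hD)

lemma continuous_logModulusDeriv_cos (hr : 0 ≤ r) (hr1 : r < 1) :
    Continuous fun θ : ℝ => logModulusDeriv c r (Real.cos θ) := by
  have hD : ∀ θ : ℝ, sqDist r (Real.cos θ) ≠ 0 := fun θ =>
    (sqDist_pos hr hr1 (Real.cos_le_one θ)).ne'
  have hc : Continuous fun θ : ℝ => sqDist r (Real.cos θ) := by unfold sqDist; fun_prop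
  unfold logModulusDeriv
  exact ((by fun_prop : Continuous _).div hc hD).add
    ((by fun_prop : Continuous _).div (hc.pow 2) fun θ => pow_ne_zero 2 (hD θ))

lemma continuous_deriv_exp_logModulus_cos (hr : 0 ≤ r) (hr1 : r < 1) :
    Continuous fun θ : ℝ => Real.exp (s * logModulus c r (Real.cos θ)) *
      (s * logModulusDeriv c r (Real.cos θ)) :=
  (continuous_const.mul (continuous_logModulus_cos hr hr1)).rexp.mul
    (continuous_const.mul (continuous_logModulusDeriv_cos hr hr1))

lemma deriv_integralMean_singularFun (hc : 0 ≤ c) (hs : 0 < s) (hr : 0 < r) (hr1 : r < 1) :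
    deriv (integralMean s (singularFun c)) r =
      (2 * Real.pi)⁻¹ * ∫ θ in 0..2 * Real.pi, Real.exp (s * logModulus c r (Real.cos θ)) *
        (s * logModulusDeriv c r (Real.cos θ)) := by
  -- Staying below the midpoint of r and 1 keeps D ≥ (1 - ρ)², hence a constant dominating function.
  set ρ := (1 + r) / 2 with hρ
  have hmem : Ioo 0 ρ ∈ nhds r := Ioo_mem_nhds hr (by linarith)
  have key := intervalIntegral.hasDerivAt_integral_of_dominated_loc_of_deriv_le
    (μ := volume) (a := 0) (b := 2 * Real.pi) (s := Ioo 0 ρ) (x₀ := r)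
    (F := fun x θ => Real.exp (s * logModulus c x (Real.cos θ)))
    (F' := fun x θ => Real.exp (s * logModulus c x (Real.cos θ)) *
      (s * logModulusDeriv c x (Real.cos θ)))
    (bound := fun _ => 4 ^ (c * s / 2) * (s * ((2 * c + 3) / (1 - ρ) ^ 2))) hmem
    (by
      filter_upwards [hmem] with x hx
      exact (continuous_const.mul (continuous_logModulus_cos hx.1.le
        (by linarith [hx.2]))).rexp.aestronglyMeasurable)
    ((continuous_const.mul (continuous_logModulus_cos hr.le hr1)).rexp.intervalIntegrable _ _)
    (continuous_deriv_exp_logModulus_cos hr.le hr1).aestronglyMeasurable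
    (by
      refine .of_forall fun θ _ x hx => ?_
      have hx1 : x < 1 := by linarith [hx.2]
      have hD := sqDist_pos hx.1.le hx1 (Real.cos_le_one θ)
      have hρ1 : 0 < 1 - ρ := by linarith
      have hDρ : (1 - ρ) ^ 2 ≤ sqDist x (Real.cos θ) :=
        (by have := hx.2; gcongr : (1 - ρ) ^ 2 ≤ (1 - x) ^ 2).trans
          (sq_one_sub_le_sqDist hx.1.le (Real.cos_le_one θ))
      rw [Real.norm_eq_abs, abs_mul, Real.abs_exp, abs_mul, abs_of_pos hs]
      gcongr
      · refine (exp_mul_logModulus_le hs.le hx.1.le hx1 (Real.cos_le_one θ)).trans ?_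
        rw [← mul_one (4 ^ (c * s / 2) : ℝ)]
        gcongr
        · exact sqDist_le_four hx.1.le hx1 (Real.neg_one_le_cos θ)
        · rw [Real.exp_le_one_iff, neg_nonpos]
          have := sub_pos.2 hx1
          positivity
      · refine (abs_logModulusDeriv_le hc hx.1.le hx1 (Real.neg_one_le_cos θ)
          (Real.cos_le_one θ)).trans ?_
        gcongr)
    intervalIntegrable_const
    (.of_forall fun θ _ x hx => hasDerivAt_exp_mul_logModulus hx.1.le (by linarith [hx.2])
      (Real.cos_le_one θ))
  exact ((key.2.const_mul (2 * Real.pi)⁻¹).congr_of_eventuallyEq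
    (.of_forall fun x => integralMean_singularFun)).deriv

/-- On (0, π], (1 - cos θ)/2 ≥ θ²/π² reduces this to θ^(2e); reflection in π gives the other half.
-/
lemma intervalIntegrable_one_sub_cos_rpow {e : ℝ} (he : -1 / 2 < e) (he0 : e ≤ 0) :
    IntervalIntegrable (fun θ : ℝ => ((1 - Real.cos θ) / 2) ^ e) volume 0 (2 * Real.pi) := by
  have hπ := Real.pi_pos
  have h1 : IntervalIntegrable (fun θ : ℝ => ((1 - Real.cos θ) / 2) ^ e) volume 0 Real.pi := by
    refine ((intervalIntegral.intervalIntegrable_rpow' (r := 2 * e) (by linarith)).const_mul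
      ((Real.pi ^ 2)⁻¹ ^ e)).mono_fun' (Measurable.aestronglyMeasurable (by fun_prop)) ?_
    rw [uIoc_of_le hπ.le]
    refine (ae_restrict_iff' measurableSet_Ioc).2 (.of_forall fun θ hθ => ?_)
    have h2 := Real.cos_le_one_sub_mul_cos_sq (abs_le.2 ⟨by linarith [hθ.1], hθ.2⟩)
    have h3 : (Real.pi ^ 2)⁻¹ * θ ^ 2 ≤ (1 - Real.cos θ) / 2 := by
      rw [div_eq_mul_inv] at h2; linarith
    have hθ0 := hθ.1
    have h4 : 0 < (Real.pi ^ 2)⁻¹ * θ ^ 2 := by positivity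
    beta_reduce
    rw [Real.norm_of_nonneg (Real.rpow_nonneg (h4.le.trans h3) e), Real.rpow_mul hθ0.le,
      Real.rpow_two, ← Real.mul_rpow (by positivity) (by positivity)]
    exact Real.rpow_le_rpow_of_nonpos h4 h3 he0
  refine h1.trans ?_
  have h2 := (h1.comp_sub_left (2 * Real.pi)).symm
  simp only [Real.cos_two_pi_sub, sub_zero] at h2
  convert h2 using 1
  ring

lemma exists_deriv_integralMean_le (hc : 0 ≤ c) (hs : 0 < s) {γ : ℝ} (hγ : 0 ≤ γ) (hγ1 : γ ≤ 1)
    (he : -1 / 2 < c * s / 2 - 1 + γ) (he0 : c * s / 2 - 1 + γ ≤ 0) :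
    ∃ C : ℝ, ∀ r : ℝ, 0 < r → r < 1 →
      deriv (integralMean s (singularFun c)) r ≤ C * (1 - r) ^ (-γ) := by
  obtain ⟨C, hC, h⟩ := exists_abs_deriv_le hc hs hγ hγ1 he0
  refine ⟨(2 * Real.pi)⁻¹ * (C * ∫ θ in 0..2 * Real.pi,
    ((1 - Real.cos θ) / 2) ^ (c * s / 2 - 1 + γ)), fun r hr hr1 => ?_⟩
  rw [deriv_integralMean_singularFun hc hs hr hr1, mul_assoc _ (C * _), mul_right_comm C,
    ← intervalIntegral.integral_const_mul (C * _)]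
  refine mul_le_mul_of_nonneg_left ?_ (by positivity)
  refine intervalIntegral.integral_mono_on_of_le_Ioo (by positivity)
    ((continuous_deriv_exp_logModulus_cos hr.le hr1).intervalIntegrable _ _)
    ((intervalIntegrable_one_sub_cos_rpow he he0).const_mul _) fun θ hθ => ?_
  refine (le_abs_self _).trans (h r _ hr.le hr1 (Real.neg_one_le_cos θ) ?_)
  refine lt_of_le_of_ne (Real.cos_le_one θ) fun h1 => ?_
  exact hθ.1.ne' ((Real.cos_eq_one_iff_of_lt_of_lt (by linarith [hθ.1, Real.pi_pos]) hθ.2).1 h1)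

lemma normPow_singularFun_lt_top {α : ℝ} (hα : α ≤ 1) (hc : 0 ≤ c) (hs : 0 < s) {γ : ℝ}
    (hγ : 0 ≤ γ) (hγα : γ < α)
    (he : -1 / 2 < c * s / 2 - 1 + γ) (he0 : c * s / 2 - 1 + γ ≤ 0) :
    normPow α s (singularFun c) < ⊤ := by
  obtain ⟨C, hC⟩ := exists_deriv_integralMean_le hc hs hγ (hγα.le.trans hα) he he0
  have h1 : IntegrableOn (fun r : ℝ => |C| * (1 - r) ^ (-γ + (α - 1))) (Ioo 0 1) := by
    have h := (intervalIntegral.intervalIntegrable_rpow' (a := 0) (b := 1)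
      (r := -γ + (α - 1)) (by linarith)).comp_sub_left 1
    rw [sub_zero, sub_self] at h
    exact ((intervalIntegrable_iff_integrableOn_Ioo_of_le zero_le_one).1 h.symm).const_mul _
  refine ENNReal.add_lt_top.2 ⟨ENNReal.ofReal_lt_top, lt_of_le_of_lt ?_ h1.lintegral_lt_top⟩
  refine setLIntegral_mono' measurableSet_Ioo fun r hr => ENNReal.ofReal_le_ofReal ?_
  have hδ : 0 < 1 - r := sub_pos.2 hr.2
  have h2 : 1 - r ≤ 1 - r ^ 2 := by nlinarith [hr.1, hr.2]
  rw [Real.rpow_add hδ, ← mul_assoc]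
  refine mul_le_mul ((hC r hr.1 hr.2).trans ?_)
    (Real.rpow_le_rpow_of_nonpos hδ h2 (by linarith))
    (Real.rpow_nonneg (hδ.le.trans h2) _) (by positivity)
  gcongr
  exact le_abs_self C

lemma exists_le_deriv_integralMean (hc : 0 ≤ c) (hs : 0 < s) :
    ∃ K C : ℝ, 0 < K ∧ ∀ r : ℝ, 0 < r → r < 1 → c * (1 - r) ≤ 1 / 4 →
      K * (1 - r) ^ ((c * s - 1) / 2) - C ≤ deriv (integralMean s (singularFun c)) r := by
  obtain ⟨C, hC, h⟩ := exists_le_deriv hc hs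
  obtain ⟨K, hK, h'⟩ := exists_le_main_term hc hs
  have hπ := Real.pi_pos
  refine ⟨(2 * Real.pi)⁻¹ * K, C, by positivity, fun r hr hr1 hcr => ?_⟩
  have hδ : 0 < 1 - r := sub_pos.2 hr1
  -- On the window [x, 2x], 1 - cos θ is comparable to 1 - r.
  set x := √(1 - r) with hx
  have hx0 : 0 < x := Real.sqrt_pos.2 hδ
  have hx2 : x ^ 2 = 1 - r := Real.sq_sqrt hδ.le
  have hx1 : x < 1 := by nlinarith
  set g : ℝ → ℝ := fun θ => Real.exp (s * logModulus c r (Real.cos θ)) *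
    (s * ((1 - Real.cos θ) / 2 / sqDist r (Real.cos θ) ^ 2)) with hg
  have hgc : Continuous g := by
    have hD : ∀ θ : ℝ, sqDist r (Real.cos θ) ^ 2 ≠ 0 := fun θ =>
      pow_ne_zero 2 (sqDist_pos hr.le hr1 (Real.cos_le_one θ)).ne'
    have hDc : Continuous fun θ : ℝ => sqDist r (Real.cos θ) := by unfold sqDist; fun_prop
    exact (continuous_const.mul (continuous_logModulus_cos hr.le hr1)).rexp.mul
      (continuous_const.mul ((by fun_prop : Continuous _).div (hDc.pow 2) hD))
  have hg0 : ∀ θ, 0 ≤ g θ := fun θ => by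
    have := sub_nonneg.2 (Real.cos_le_one θ)
    positivity
  have h1 : ∫ θ in x..2 * x, K * ((1 - r) ^ (c * s / 2) / (1 - r)) ≤ ∫ θ in x..2 * x, g θ := by
    refine intervalIntegral.integral_mono_on (by linarith) intervalIntegrable_const
      (hgc.intervalIntegrable _ _) fun θ hθ => ?_
    refine h' r _ hr.le hr1 (Real.neg_one_le_cos θ) ?_ ?_
    · have h2 := Real.cos_le_one_sub_mul_cos_sq
        (abs_le.2 ⟨by linarith [hθ.1], by linarith [hθ.2, Real.pi_gt_three]⟩ : |θ| ≤ Real.pi)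
      have h3 : 1 / 5 ≤ 2 / Real.pi ^ 2 := by
        rw [div_le_div_iff₀ (by norm_num) (by positivity)]
        nlinarith [Real.pi_lt_d2]
      have h4 : x ^ 2 ≤ θ ^ 2 := by have := hθ.1; gcongr
      have h5 : 1 / 5 * x ^ 2 ≤ 2 / Real.pi ^ 2 * θ ^ 2 := by gcongr
      linarith
    · have h2 := Real.one_sub_sq_div_two_le_cos (x := θ)
      have h4 : θ ^ 2 ≤ (2 * x) ^ 2 := by
        exact pow_le_pow_left₀ (hx0.le.trans hθ.1) hθ.2 2
      nlinarith
  have h2 : ∫ θ in x..2 * x, g θ ≤ ∫ θ in 0..2 * Real.pi, g θ :=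
    intervalIntegral.integral_mono_interval hx0.le (by linarith)
      (by linarith [Real.pi_gt_three]) (.of_forall hg0) (hgc.intervalIntegrable _ _)
  have h3 : ∫ θ in 0..2 * Real.pi, (g θ - C) ≤ ∫ θ in 0..2 * Real.pi,
      Real.exp (s * logModulus c r (Real.cos θ)) * (s * logModulusDeriv c r (Real.cos θ)) :=
    intervalIntegral.integral_mono_on (by positivity)
      ((hgc.sub continuous_const).intervalIntegrable _ _)
      ((continuous_deriv_exp_logModulus_cos hr.le hr1).intervalIntegrable _ _)
      fun θ _ => h r _ hr.le hr1 (Real.neg_one_le_cos θ) (Real.cos_le_one θ) hcr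
  rw [intervalIntegral.integral_sub (hgc.intervalIntegrable _ _) intervalIntegrable_const,
    intervalIntegral.integral_const, smul_eq_mul, sub_zero] at h3
  rw [intervalIntegral.integral_const, smul_eq_mul] at h1
  have h4 : (2 * x - x) * (K * ((1 - r) ^ (c * s / 2) / (1 - r))) =
      K * (1 - r) ^ ((c * s - 1) / 2) := by
    have h5 : x * (1 - r) ^ (c * s / 2) / (1 - r) = (1 - r) ^ ((c * s - 1) / 2) := by
      rw [hx, Real.sqrt_eq_rpow, ← Real.rpow_add hδ]
      nth_rewrite 2 [← Real.rpow_one (1 - r)]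
      rw [← Real.rpow_sub hδ]
      congr 1; ring
    rw [← h5]; ring
  rw [deriv_integralMean_singularFun hc hs hr hr1]
  have h6 : (2 * Real.pi)⁻¹ * (K * (1 - r) ^ ((c * s - 1) / 2) - 2 * Real.pi * C) ≤
      (2 * Real.pi)⁻¹ * ∫ θ in 0..2 * Real.pi,
        Real.exp (s * logModulus c r (Real.cos θ)) * (s * logModulusDeriv c r (Real.cos θ)) :=
    mul_le_mul_of_nonneg_left (by linarith) (by positivity)
  refine le_trans (le_of_eq ?_) h6
  field_simp

lemma setLIntegral_div_one_sub_eq_top {K ε : ℝ} (hK : 0 < K) (hε : 0 < ε) :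
    ∫⁻ r in Ioo (1 - ε) 1, ENNReal.ofReal (K / (1 - r)) = ⊤ := by
  by_contra hne
  have h0 : 0 ≤ᵐ[volume.restrict (Ioo (1 - ε) 1)] fun r : ℝ => K / (1 - r) :=
    (ae_restrict_iff' measurableSet_Ioo).2 (.of_forall fun r hr =>
      div_nonneg hK.le (sub_nonneg.2 hr.2.le))
  have h1 : IntegrableOn (fun r : ℝ => K / (1 - r)) (Ioo (1 - ε) 1) :=
    ⟨Measurable.aestronglyMeasurable (by fun_prop),
      (hasFiniteIntegral_iff_ofReal h0).2 (lt_top_iff_ne_top.2 hne)⟩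
  have h2 : IntervalIntegrable (fun r : ℝ => (r - 1)⁻¹) volume (1 - ε) 1 := by
    rw [intervalIntegrable_iff_integrableOn_Ioo_of_le (by linarith)]
    refine IntegrableOn.congr_fun (h1.const_mul (-K⁻¹)) (fun r hr => ?_) measurableSet_Ioo
    have h3 : 1 - r ≠ 0 := (sub_pos.2 hr.2).ne'
    rw [← neg_sub 1 r, inv_neg]
    field_simp
  rcases intervalIntegrable_sub_inv_iff.1 h2 with h | h
  · linarith
  · exact h right_mem_uIcc

lemma normPow_singularFun_eq_top {α : ℝ} (hα : α ≤ 1) (hc : 0 < c) (hs : 0 < s)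
    (hcs : c * s < 1) (hcα : c * s ≤ 1 - 2 * α) : normPow α s (singularFun c) = ⊤ := by
  obtain ⟨K, C, hK, h⟩ := exists_le_deriv_integralMean hc.le hs
  set β := (c * s - 1) / 2 with hβ
  have hβ0 : β < 0 := by rw [hβ]; linarith
  -- As β < 0, near the circle half of the main term absorbs the constant C.
  have hlim : ∀ᶠ x : ℝ in nhdsWithin 0 (Ioi 0), 2 * C / K ≤ x ^ β :=
    (tendsto_rpow_neg_nhdsGT_zero hβ0).eventually_ge_atTop _
  obtain ⟨ε₀, hε₀, hε₀'⟩ := mem_nhdsGT_iff_exists_Ioo_subset.1 hlim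
  set ε := min ε₀ (min 1 (1 / (4 * c))) with hε
  have hε0 : 0 < ε := lt_min hε₀ (by positivity)
  have hε1 : ε ≤ 1 := (min_le_right _ _).trans (min_le_left _ _)
  have hεc : ε ≤ 1 / (4 * c) := (min_le_right _ _).trans (min_le_right _ _)
  refine ENNReal.add_eq_top.2 (.inr (top_le_iff.1 ?_))
  rw [← setLIntegral_div_one_sub_eq_top (K := K / 2 * 2 ^ (α - 1)) (by positivity) hε0]
  refine (setLIntegral_mono' measurableSet_Ioo fun r hr => ENNReal.ofReal_le_ofReal ?_).trans
    (lintegral_mono_set (Ioo_subset_Ioo_left (by linarith)))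
  have hδ : 0 < 1 - r := sub_pos.2 hr.2
  have hδε : 1 - r < ε := by linarith [hr.1]
  have hr0 : 0 < r := by linarith
  have hcr : c * (1 - r) ≤ 1 / 4 := by
    calc c * (1 - r) ≤ c * (1 / (4 * c)) := by gcongr; linarith
      _ = 1 / 4 := by field_simp
  have h1 : K / 2 * (1 - r) ^ β ≤ deriv (integralMean s (singularFun c)) r := by
    refine le_trans ?_ (h r hr0 hr.2 hcr)
    have h2 : 2 * C / K ≤ (1 - r) ^ β := hε₀' ⟨hδ, hδε.trans_le (min_le_left _ _)⟩
    rw [div_le_iff₀ hK] at h2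
    linarith
  have h2 : (2 * (1 - r)) ^ (α - 1) ≤ (1 - r ^ 2) ^ (α - 1) :=
    Real.rpow_le_rpow_of_nonpos (by nlinarith) (by nlinarith) (by linarith)
  calc K / 2 * 2 ^ (α - 1) / (1 - r) = K / 2 * 2 ^ (α - 1) * (1 - r) ^ (-1 : ℝ) := by
        rw [Real.rpow_neg_one, div_eq_mul_inv]
    _ ≤ K / 2 * 2 ^ (α - 1) * (1 - r) ^ (β + (α - 1)) := by
        refine mul_le_mul_of_nonneg_left ?_ (by positivity)
        exact Real.rpow_le_rpow_of_exponent_ge hδ (by linarith) (by rw [hβ]; linarith)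
    _ = K / 2 * (1 - r) ^ β * (2 * (1 - r)) ^ (α - 1) := by
        rw [Real.rpow_add hδ, Real.mul_rpow (by norm_num) hδ.le]; ring
    _ ≤ _ := mul_le_mul h1 h2 (by positivity) ((by positivity : (0 : ℝ) ≤ _).trans h1)

end Analytic

theorem mainTheorem7 (α p q : ℝ) (hα0 : 0 < α) (hα1 : α < 1 / 2) (hq : 0 < q) (hqp : q < p) :
    ¬ classA α p ⊆ classA α q ∧
      ∃ f : ℂ → ℂ, DifferentiableOn ℂ f (Metric.ball 0 1) ∧
        weightedNorm α p f < ∞ ∧ weightedNorm α q f = ∞ ∧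
        ¬ MonotoneOn (fun s : ℝ => weightedNorm α s f) (Set.Ioi 0) := by
  have hp : 0 < p := hq.trans hqp
  -- b is cp; the upper bounds give cq < 1 - 2α and, through b < 1, a positive γ below.
  obtain ⟨b, hb1, hb2⟩ : ∃ b, 1 - 2 * α < b ∧ b < min 1 ((1 - 2 * α) * (p / q)) := by
    refine exists_between (lt_min (by linarith) ?_)
    exact lt_mul_of_one_lt_right (by linarith) ((one_lt_div hq).2 hqp)
  obtain ⟨hb3, hb4⟩ := lt_min_iff.1 hb2
  have hb0 : 0 < b := by linarith
  have hbq : b / p * q < 1 - 2 * α := by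
    rw [← mul_div_assoc, lt_div_iff₀ hq] at hb4
    rw [div_mul_eq_mul_div, div_lt_iff₀ hp]
    exact hb4
  have hbp : b / p * p = b := div_mul_cancel₀ _ hp.ne'
  -- γ > (1 - b)/2 gives integrability in θ, γ < α integrability in r.
  obtain ⟨γ, hγ1, hγ2⟩ := exists_between (by linarith : (1 - b) / 2 < α)
  have hP : normPow α p (singularFun (b / p)) < ∞ :=
    normPow_singularFun_lt_top (γ := γ) (by linarith) (by positivity) hp (by linarith) hγ2
      (by rw [hbp]; linarith) (by rw [hbp]; linarith)
  have hQ : normPow α q (singularFun (b / p)) = ∞ :=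
    normPow_singularFun_eq_top (by linarith) (by positivity) hq (by linarith) hbq.le
  have hP' : weightedNorm α p (singularFun (b / p)) < ∞ :=
    ENNReal.rpow_lt_top_of_nonneg (by positivity) hP.ne
  have hQ' : weightedNorm α q (singularFun (b / p)) = ∞ := by
    rw [weightedNorm, hQ, ENNReal.top_rpow_of_pos (by positivity)]
  have hd := differentiableOn_singularFun (b / p)
  refine ⟨fun h => (h ⟨hd, hP⟩).2.ne hQ, _, hd, hP', hQ', fun h => ?_⟩
  have h1 := h (Set.mem_Ioi.2 hq) (Set.mem_Ioi.2 hp) hqp.le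
  exact (h1.trans_lt hP').ne hQ'
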